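/- Let $R$ be a commutative noetherian local ring with maximal ideal $\mathfrak m$ and residue field $k=R/\mathfrak m$, such that $\mathfrak m^3=0\neq\mathfrak m^2$, and assume that $R$ is not Gorenstein (that is, $R$ does not have finite injective dimension as an $R$-module). Put $$a=\operatorname{rank}_k \mathfrak m^2,\qquad e=\operatorname{rank}_k \mathfrak m/\mathfrak m^2,\qquad r=\operatorname{rank}_k \operatorname{Soc} R,$$ where $\operatorname{Soc}R=\{x\in R\mid \mathfrak m x=0\}$. For a finitely generated $R$-module $M$ let $\beta_i(M)=\operatorname{rank}_k\operatorname{Ext}^i_R(M,k)$ denote its $i$-th Betti number, let $M_0=M$, and for $i\ge 1$ let $M_i$ denote the $i$-th syzygy in a minimal free resolution of $M$. Let $M$ be a finitely generated $R$-module with $\beta_1(M)>\beta_0(M)$. Then the following hold. (a) If $a\neq e$ or $a\neq r$, then the sequence $(\beta_i(M))_{i\ge 0}$ is strictly increasing and has termwise exponential growth, i.e. there is a real number $A>1$ such that $\beta_{i+1}(M)\ge A\,\beta_i(M)$ for all sufficiently large $i$. (b) If $a=e=r$, then the sequence $(\beta_i(M))_{i\ge 0}$ is non-decreasing, and $\beta_i(M)>\beta_{i-1}(M)$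 holds for all $i\ge 1$ except possibly one. Moreover, if $\beta_j(M)=\beta_{j-1}(M)$ for some $j\ge 1$, then $j\ge 2$, and $k$ is a direct summand of $M_{j+1}$ but not a direct summand of $M_i$ for any $0\le i\le j$. -/

import Mathlib

open CategoryTheory IsLocalRing Filter

universe u

namespace LocalRingBetti

/-- The rank over the residue field `k = R/𝔪` of an `R`-module `V` that is annihilated by `𝔪`,
where `V` carries its induced structure of a `k`-vector space. -/
noncomputable def residueRank {R : Type u} [CommRing R] [IsLocalRing R]
    {V : Type*} [AddCommGroup V] [Module R V]
    (hV : Module.IsTorsionBySet R V (maximalIdeal R)) : ℕ :=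
  letI : Module (ResidueField R) V := hV.module
  Module.finrank (ResidueField R) V

/-- The maximal ideal annihilates `Ext^i_R(M, k)`. -/
theorem isTorsionBySet_ext (R : Type u) [CommRing R] [IsLocalRing R]
    (M : Type u) [AddCommGroup M] [Module R M] (i : ℕ) :
    Module.IsTorsionBySet R
      (Abelian.Ext (ModuleCat.of R M) (ModuleCat.of R (ResidueField R)) i) (maximalIdeal R) := by
  rintro x ⟨r, hr⟩
  have h0 : r • (𝟙 (ModuleCat.of R (ResidueField R))) = 0 := by
    ext y
    change r • y = 0
    rw [Algebra.smul_def, ResidueField.algebraMap_eq, (residue_eq_zero_iff r).2 hr, zero_mul]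
  change r • x = 0
  rw [← Abelian.Ext.comp_mk₀_id x, ← Abelian.Ext.comp_smul, ← Abelian.Ext.mk₀_smul, h0,
    Abelian.Ext.mk₀_zero, Abelian.Ext.comp_zero]

/-- The `i`-th Betti number `β_i(M) = rank_k Ext^i_R(M, k)`. -/
noncomputable def betti (R : Type u) [CommRing R] [IsLocalRing R]
    (M : Type u) [AddCommGroup M] [Module R M] (i : ℕ) : ℕ :=
  residueRank (isTorsionBySet_ext R M i)

/-- A (noetherian) local ring is Gorenstein if it has finite injective dimension as a module
over itself. -/
def IsGorensteinLocal (R : Type u) [CommRing R] [IsLocalRing R] : Prop :=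
  IsNoetherianRing R ∧ ∃ n : ℕ, HasInjectiveDimensionLE (ModuleCat.of R R) n

/-- The embedding dimension: the rank of the `k`-vector space `𝔪/𝔪²`. -/
noncomputable def embDim (R : Type u) [CommRing R] [IsLocalRing R] : ℕ :=
  Module.finrank (ResidueField R) (CotangentSpace R)

/-- The socle `Soc R = {x | 𝔪 x = 0}`. -/
def socle (R : Type u) [CommRing R] [IsLocalRing R] : Submodule R R :=
  Submodule.torsionBySet R R (maximalIdeal R)

/-- The socle rank: the rank of the `k`-vector space `Soc R`. -/
noncomputable def socleRank (R : Type u) [CommRing R] [IsLocalRing R] : ℕ :=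
  residueRank (R := R) (V := socle R)
    (Submodule.torsionBySet_isTorsionBySet (maximalIdeal R : Set R))

/-- If `𝔪³ = 0`, then `𝔪` annihilates `𝔪²`. -/
theorem isTorsionBySet_sq {R : Type u} [CommRing R] [IsLocalRing R]
    (h3 : maximalIdeal R ^ 3 = ⊥) :
    Module.IsTorsionBySet R (maximalIdeal R ^ 2 : Ideal R) (maximalIdeal R) := by
  rintro ⟨x, hx⟩ ⟨r, hr⟩
  have h : r * x ∈ maximalIdeal R ^ 3 := by
    rw [pow_succ' (maximalIdeal R) 2]
    exact Ideal.mul_mem_mul hr hx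
  rw [h3] at h
  exact Subtype.ext h

/-- The residue field `k` is (isomorphic to) a direct summand of `N`. -/
def HasResidueSummand (R : Type u) [CommRing R] [IsLocalRing R]
    (N : Type*) [AddCommGroup N] [Module R N] : Prop :=
  ∃ P Q : Submodule R N, IsCompl P Q ∧ Nonempty (P ≃ₗ[R] ResidueField R)

/-- A minimal free resolution `⋯ → R^{n₂} → R^{n₁} → R^{n₀} → M → 0` of a module over a local
ring, by finitely generated free modules. -/
structure MinimalFreeResolution (R : Type u) [CommRing R] [IsLocalRing R]
    (M : Type u) [AddCommGroup M] [Module R M] where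
  /-- the ranks of the free modules -/
  rank : ℕ → ℕ
  /-- the augmentation -/
  aug : (Fin (rank 0) → R) →ₗ[R] M
  /-- the differentials -/
  d : ∀ i : ℕ, (Fin (rank (i + 1)) → R) →ₗ[R] (Fin (rank i) → R)
  aug_surjective : Function.Surjective aug
  exact_zero : LinearMap.range (d 0) = LinearMap.ker aug
  exact_succ : ∀ i : ℕ, LinearMap.range (d (i + 1)) = LinearMap.ker (d i)
  minimal : ∀ i : ℕ, LinearMap.range (d i) ≤ maximalIdeal R • ⊤

/-- The residue field is a direct summand of the `i`-th syzygy `M_i` in the given minimal free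
resolution of `M`, where `M_0 = M` and `M_{i+1}` is the image of the differential
`R^{n_{i+1}} → R^{n_i}`. -/
def MinimalFreeResolution.ResidueSummandOfSyzygy {R : Type u} [CommRing R] [IsLocalRing R]
    {M : Type u} [AddCommGroup M] [Module R M] (F : MinimalFreeResolution R M) : ℕ → Prop
  | 0 => HasResidueSummand R M
  | i + 1 => HasResidueSummand R (LinearMap.range (F.d i))

/-- Termwise exponential growth: there is a real number `A > 1` with `b_{i+1} ≥ A b_i` for all
sufficiently large `i`. -/
def TermwiseExponentialGrowth (b : ℕ → ℕ) : Prop :=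
  ∃ A : ℝ, 1 < A ∧ ∀ᶠ i in atTop, A * (b i : ℝ) ≤ (b (i + 1) : ℝ)

/-- Every finitely generated module has a minimal free cover. -/
theorem exists_minimal_free_cover {R : Type u} [CommRing R] [IsLocalRing R] (N : Type u) [AddCommGroup N] [Module R N]
    [Module.Finite R N] : ∃ (n : ℕ) (f : (Fin n → R) →ₗ[R] N), Function.Surjective f ∧
      LinearMap.ker f ≤ maximalIdeal R • ⊤ := by
  classical
  let k := ResidueField R
  let b := Module.finBasis k (TensorProduct R k N)
  have hs : Function.Surjective (TensorProduct.mk R k N 1) :=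
    TensorProduct.mk_surjective R N k residue_surjective
  choose v hv using fun i => hs (b i)
  refine ⟨_, Fintype.linearCombination R v, ?_, ?_⟩
  · rw [← LinearMap.range_eq_top, Fintype.range_linearCombination]
    exact IsLocalRing.span_eq_top_of_tmul_eq_basis v b hv
  · intro x hx
    have h1 : ∑ i, x i • v i = 0 := by simpa [Fintype.linearCombination_apply] using hx
    have h2 : ∑ i, (residue R (x i)) • b i = 0 := by
      have := congrArg (TensorProduct.mk R k N 1) h1
      simp only [map_sum, map_smul, hv, map_zero] at this
      rw [← this]
      refine Finset.sum_congr rfl fun i _ => ?_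
      exact algebraMap_smul (ResidueField R) (x i) (b i)
    have h3 := Fintype.linearIndependent_iff.1 b.linearIndependent _ h2
    have : x = ∑ i, x i • (Pi.single i (1:R) : _ → R) := by
      ext j; simp [Finset.sum_apply, Pi.single_apply]
    rw [this]
    exact Submodule.sum_mem _ fun i _ => Submodule.smul_mem_smul ((residue_eq_zero_iff _).1 (h3 i)) trivial

/-- Minimal free resolutions exist, so quantifying over all of them is not vacuous. -/
theorem nonempty_minimalFreeResolution {R : Type u} [CommRing R] [IsLocalRing R]
    [IsNoetherianRing R] (M : Type u) [AddCommGroup M] [Module R M] [Module.Finite R M] :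
    Nonempty (MinimalFreeResolution R M) := by
  obtain ⟨n, f, hf, hk⟩ := exists_minimal_free_cover (R := R) M
  have step : ∀ (m : ℕ) (K : Submodule R (Fin m → R)),
    ∃ (n : ℕ) (g : (Fin n → R) →ₗ[R] (Fin m → R)), LinearMap.range g = K ∧
      LinearMap.ker g ≤ maximalIdeal R • ⊤ := by
    intro m K
    obtain ⟨n, g, hg, hk⟩ := exists_minimal_free_cover (R := R) K
    refine ⟨n, K.subtype ∘ₗ g, ?_, ?_⟩
    · rw [LinearMap.range_comp, LinearMap.range_eq_top.2 hg]; simp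
    · rwa [LinearMap.ker_comp_of_ker_eq_bot _ K.ker_subtype]
  choose N G hG1 hG2 using step
  let S : ℕ → Σ m : ℕ, {K : Submodule R (Fin m → R) // K ≤ maximalIdeal R • ⊤} := fun i =>
    Nat.rec ⟨n, LinearMap.ker f, hk⟩ (fun _ p => ⟨N p.1 p.2.1, LinearMap.ker (G p.1 p.2.1), hG2 _ _⟩) i
  exact ⟨{
    rank := fun i => (S i).1
    aug := f
    d := fun i => G (S i).1 (S i).2.1
    aug_surjective := hf
    exact_zero := hG1 _ _
    exact_succ := fun i => hG1 _ _
    minimal := fun i => (hG1 _ _).le.trans (S i).2.2 }⟩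
end LocalRingBetti

/-!
Write `s_i` for the length of `𝔪 M_i`. Length counts in a minimal resolution give
`β_{i+1} + s_{i+1} + s_i = β_i (e + a)` and `s_{i+1} ≤ a β_i`. Since `𝔪 M_{i+2}` is generated by
the products of generators of `𝔪` with lifts of a basis of `M_{i+2} / (Soc R) F_{i+1}`, also
`s_{i+2} ≤ e (β_{i+2} + s_{i+2} - r β_{i+1})`. As `R` is not Gorenstein, `r ≥ 2`, and these three
relations alone force exponential growth unless `a = e = r`; in that case they force
`β_{i+1} ≤ β_{i+2}`, with equality only if `s_{i+2} = e β_{i+2}`.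

Let `a = e = r`. Always `s_i ≤ e β_i` for `i > 0`, and the inequality is strict for every syzygy of
`k`, hence, both sides being additive, for `M_i` if `k` is a direct summand of `M_n` with `n ≤ i`.
For the syzygies `k_n` of `k` and `e ≥ 4` this follows from the relations. For `e ≤ 3` there are
fewer than `e a` conditions expressing that a family of functionals on `𝔪²` is symmetric with
respect to multiplication; a nonzero such family annihilates `𝔪 k_2`, so `k` is a direct summand of
`k_2`, and strictness propagates from `k_n` to `k_{n+2}`. Thus a repetition `β_j = β_{j-1}`, where
`s_j = e β_j`, excludes the summand `k` from all `M_i` with `i ≤ j`. It also gives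
`s_{j+1} = e β_j - β_{j+1} < a β_j`, so that some socle element of `F_j` in `M_{j+1}` lies outside
`𝔪 M_{j+1}` and splits off `k`.
-/

namespace LocalRingBetti

section Length

variable {R : Type*} [CommRing R]

/-- The length of a module as a natural number, with the convention that it is `0` for modules of
infinite length. Over a local ring it is the rank over `k` of the modules annihilated by `𝔪`. -/
noncomputable def len (R : Type*) [CommRing R] (N : Type*) [AddCommGroup N] [Module R N] : ℕ :=
  (Module.length R N).toNat

variable {M N P : Type*} [AddCommGroup M] [Module R M] [AddCommGroup N] [Module R N]
  [AddCommGroup P] [Module R P]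

theorem len_congr (e : N ≃ₗ[R] P) : len R N = len R P := by
  rw [len, len, e.length_eq]

theorem len_fun (ι : Type*) [Fintype ι] : len R (ι → N) = Fintype.card ι * len R N := by
  simp [len]

theorem len_eq_zero_of_subsingleton [Subsingleton N] : len R N = 0 := by
  rw [len, Module.length_eq_zero, ENat.toNat_zero]

theorem len_prod [IsArtinian R N] [IsNoetherian R N] [IsArtinian R P] [IsNoetherian R P] :
    len R (N × P) = len R N + len R P := by
  rw [len, Module.length_prod, ENat.toNat_add Module.length_ne_top Module.length_ne_top, len, len]

variable [IsArtinian R M] [IsNoetherian R M]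

theorem len_add_len_quotient (p : Submodule R M) : len R p + len R (M ⧸ p) = len R M := by
  rw [len, len, len, Module.length_eq_add_of_exact p.subtype p.mkQ p.injective_subtype
    p.mkQ_surjective (LinearMap.exact_subtype_mkQ p),
    ENat.toNat_add Module.length_ne_top Module.length_ne_top]

theorem len_ker_add_len_range (f : M →ₗ[R] P) :
    len R (LinearMap.ker f) + len R (LinearMap.range f) = len R M := by
  rw [← len_congr f.quotKerEquivRange, len_add_len_quotient]

theorem len_ker_add_len_of_surjective {f : M →ₗ[R] P} (hf : Function.Surjective f) :
    len R (LinearMap.ker f) + len R P = len R M := by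
  rw [← len_congr (f.quotKerEquivOfSurjective hf), len_add_len_quotient]

theorem len_le_of_injective {f : N →ₗ[R] M} (hf : Function.Injective f) : len R N ≤ len R M :=
  ENat.toNat_le_toNat (Module.length_le_of_injective f hf) Module.length_ne_top

theorem len_le_of_le {p q : Submodule R M} (h : p ≤ q) : len R p ≤ len R q :=
  len_le_of_injective (Submodule.inclusion_injective h)

theorem len_pos [Nontrivial M] : 0 < len R M :=
  Nat.pos_of_ne_zero fun h =>
    (ENat.toNat_eq_zero.1 h).elim Module.length_pos.ne' Module.length_ne_top

theorem len_ker_lt {f : M →ₗ[R] P} (hf : f ≠ 0) : len R (LinearMap.ker f) < len R M := by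
  have : Nontrivial (LinearMap.range f) :=
    Submodule.nontrivial_iff_ne_bot.2 (mt LinearMap.range_eq_bot.1 hf)
  rw [← len_ker_add_len_range f]
  exact Nat.lt_add_of_pos_right len_pos

theorem residueRank_eq_len {R : Type u} [CommRing R] [IsLocalRing R] {V : Type*} [AddCommGroup V]
    [Module R V] (hV : Module.IsTorsionBySet R V (maximalIdeal R)) :
    residueRank hV = len R V := by
  let : Module (ResidueField R) V := hV.module
  have : IsScalarTower R (ResidueField R) V := hV.isScalarTower
  rw [len, Module.length_eq_of_surjective (R := ResidueField R) residue_surjective,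
    Module.length_eq_rank]
  rfl

theorem len_residueField [IsLocalRing R] : len R (ResidueField R) = 1 := by
  rw [len, Module.length_eq_of_surjective (R := ResidueField R) residue_surjective,
    Module.length_eq_one]
  rfl

end Length

section Ext

variable {R : Type u} [CommRing R] [IsLocalRing R]

theorem apply_eq_zero_of_mem_smul_top {N : Type*} [AddCommGroup N] [Module R N]
    (h : N →ₗ[R] ResidueField R) {x : N} (hx : x ∈ maximalIdeal R • (⊤ : Submodule R N)) :
    h x = 0 := by
  induction hx using Submodule.smul_induction_on' with
  | smul r hr n _ =>
    rw [map_smul, Algebra.smul_def, ResidueField.algebraMap_eq, (residue_eq_zero_iff r).2 hr,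
      zero_mul]
  | add x _ y _ hx hy => rw [map_add, hx, hy, add_zero]

/-- A surjection whose kernel lies in `𝔪 F`; for a free module `F` of finite rank this says that
the images of the basis vectors form a minimal system of generators. -/
structure IsMinimalCover {F N : Type*} [AddCommGroup F] [Module R F] [AddCommGroup N] [Module R N]
    (f : F →ₗ[R] N) : Prop where
  surjective : Function.Surjective f
  ker_le : LinearMap.ker f ≤ maximalIdeal R • ⊤

theorem IsMinimalCover.lcomp_bijective {F N : Type*} [AddCommGroup F] [Module R F]
    [AddCommGroup N] [Module R N] {f : F →ₗ[R] N} (hf : IsMinimalCover f) :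
    Function.Bijective (LinearMap.lcomp R (ResidueField R) f) := by
  refine ⟨LinearMap.lcomp_injective_of_surjective f hf.surjective, fun h => ?_⟩
  have hexact := LinearMap.exact_lcomp_of_exact_of_surjective (ResidueField R)
    (LinearMap.exact_subtype_ker_map f) hf.surjective
  exact (hexact h).1 (LinearMap.ext fun x => apply_eq_zero_of_mem_smul_top h (hf.ker_le x.2))

theorem betti_eq_len (M : Type u) [AddCommGroup M] [Module R M] (i : ℕ) :
    betti R M i = len R (Abelian.Ext (ModuleCat.of R M) (ModuleCat.of R (ResidueField R)) i) :=
  residueRank_eq_len _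

variable {M : Type u} [AddCommGroup M] [Module R M]

theorem IsMinimalCover.betti_zero {n : ℕ} {f : (Fin n → R) →ₗ[R] M} (hf : IsMinimalCover f) :
    betti R M 0 = n := by
  let homEquiv : Abelian.Ext (ModuleCat.of R M) (ModuleCat.of R (ResidueField R)) 0 ≃ₗ[R]
      (M →ₗ[R] ResidueField R) := Abelian.Ext.linearEquiv₀.trans ModuleCat.homLinearEquiv
  let lcompEquiv := LinearEquiv.ofBijective _ hf.lcomp_bijective
  rw [betti_eq_len, len_congr (homEquiv.trans (lcompEquiv.trans (LinearEquiv.piRing R _ _ R))),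
    len_fun, len_residueField, Fintype.card_fin, mul_one]

theorem IsMinimalCover.precomp_extClass_bijective {F : Type u} [AddCommGroup F] [Module R F]
    [Module.Projective R F] {f : F →ₗ[R] M} (hf : IsMinimalCover f) (i : ℕ) :
    Function.Bijective <|
      (LinearMap.shortExact_shortComplexKer hf.surjective).extClass.precompOfLinear R
        (ModuleCat.of R (ResidueField R)) (add_comm 1 i) := by
  let exac := LinearMap.shortExact_shortComplexKer hf.surjective
  let K := ModuleCat.of R (ResidueField R)
  have : Projective f.shortComplexKer.X₂ := inferInstanceAs (Projective (ModuleCat.of R F))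
  refine ⟨?_, precomp_extClass_surjective_of_projective_X₂ K exac i⟩
  rw [← LinearMap.ker_eq_bot, LinearMap.ker_eq_bot']
  intro x hx
  obtain ⟨y, rfl⟩ := Abelian.Ext.contravariant_sequence_exact₁ exac K x (add_comm 1 i) hx
  cases i with
  | succ i => rw [Abelian.Ext.eq_zero_of_projective y, Abelian.Ext.comp_zero]
  | zero =>
    obtain ⟨h, rfl⟩ := Abelian.Ext.homEquiv₀.symm.surjective y
    have hzero : f.shortComplexKer.f ≫ h = 0 := by
      ext z
      exact apply_eq_zero_of_mem_smul_top h.hom (hf.ker_le z.2)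
    change (Abelian.Ext.mk₀ _).comp (Abelian.Ext.mk₀ h) _ = 0
    rw [Abelian.Ext.mk₀_comp_mk₀, hzero, Abelian.Ext.mk₀_zero]

theorem IsMinimalCover.betti_succ {F : Type u} [AddCommGroup F] [Module R F]
    [Module.Projective R F] {f : F →ₗ[R] M} (hf : IsMinimalCover f) (i : ℕ) :
    betti R M (i + 1) = betti R (LinearMap.ker f) i := by
  rw [betti_eq_len, betti_eq_len]
  exact (len_congr (LinearEquiv.ofBijective _ (hf.precomp_extClass_bijective i))).symm

theorem betti_eq_add_of_equiv_prod [IsArtinianRing R] {P Q : Type u}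
    [AddCommGroup P] [Module R P] [Module.Finite R P] [AddCommGroup Q] [Module R Q]
    [Module.Finite R Q] (e : M ≃ₗ[R] P × Q) (i : ℕ) :
    betti R M i = betti R P i + betti R Q i := by
  let K := ModuleCat.of R (ResidueField R)
  let φ : ModuleCat.of R M ≅ ModuleCat.of R P ⊞ ModuleCat.of R Q :=
    e.toModuleIso ≪≫ (ModuleCat.biprodIsoProd (.of R P) (.of R Q)).symm
  let precomp {X Y : ModuleCat.{u} R} (g : X ⟶ Y) :=
    (Abelian.Ext.mk₀ g).precompOfLinear R K (zero_add i)
  let congrEquiv : Abelian.Ext (ModuleCat.of R M) K i ≃ₗ[R] Abelian.Ext (.of R P ⊞ .of R Q) K i :=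
    .ofLinearMap (precomp φ.inv) (precomp φ.hom) (by ext; simp [precomp]) (by ext; simp [precomp])
  let prodEquiv := (Abelian.Ext.biprodAddEquiv (X₁ := ModuleCat.of R P) (X₂ := ModuleCat.of R Q)
    (Y := K) (n := i)).toLinearEquiv fun (r : R) x => by ext <;> simp
  rw [betti_eq_len, betti_eq_len, betti_eq_len, len_congr (congrEquiv.trans prodEquiv), len_prod]

end Ext

section Modules

variable {R : Type u} [CommRing R]

theorem mem_smul_top_fun {n : ℕ} (I : Ideal R) {x : Fin n → R} :
    x ∈ I • (⊤ : Submodule R (Fin n → R)) ↔ ∀ i, x i ∈ I := by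
  refine ⟨fun hx i => ?_, fun hx => ?_⟩
  · let proj : (Fin n → R) →ₗ[R] R := LinearMap.proj i
    have hmem : proj x ∈ (I • ⊤ : Submodule R (Fin n → R)).map proj := Submodule.mem_map_of_mem hx
    rw [Submodule.map_smul''] at hmem
    exact Ideal.mul_le_left hmem
  · rw [pi_eq_sum_univ' x]
    exact Submodule.sum_mem _ fun i _ => Submodule.smul_mem_smul (hx i) trivial

theorem len_smul_top_fun (n : ℕ) (I : Ideal R) :
    len R (I • ⊤ : Submodule R (Fin n → R)) = n * len R I := by
  have hrange : LinearMap.range (I.subtype.compLeft (Fin n)) = I • ⊤ := by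
    ext x
    rw [mem_smul_top_fun]
    exact ⟨by rintro ⟨y, rfl⟩ i; exact (y i).2, fun hx => ⟨fun i => ⟨x i, hx i⟩, rfl⟩⟩
  rw [← hrange, ← len_congr (LinearEquiv.ofInjective (I.subtype.compLeft (Fin n))
    (I.injective_subtype.comp_left)), len_fun, Fintype.card_fin]

theorem smul_top_eq_bot_of_le {N : Type*} [AddCommGroup N] [Module R N] {X Y : Submodule R N}
    {I : Ideal R} (h : X ≤ Y) (hI : I • Y = ⊥) : I • (⊤ : Submodule R X) = ⊥ := by
  refine Submodule.map_injective_of_injective X.injective_subtype ?_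
  rw [Submodule.map_smul'', Submodule.map_subtype_top, Submodule.map_bot, eq_bot_iff, ← hI]
  exact Submodule.smul_mono le_rfl h

theorem len_smul_top_submodule {N : Type*} [AddCommGroup N] [Module R N] (I : Ideal R)
    (X : Submodule R N) :
    len R (I • ⊤ : Submodule R X) = len R (I • X : Submodule R N) := by
  have hmap : (I • ⊤ : Submodule R X).map X.subtype = I • X := by
    rw [Submodule.map_smul'', Submodule.map_subtype_top]
  rw [← hmap]
  exact len_congr (Submodule.equivMapOfInjective _ X.injective_subtype _)

theorem len_smul_top_le {N : Type*} [AddCommGroup N] [Module R N] [IsArtinian R N]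
    [IsNoetherian R N] {I : Ideal R} (hI : I.FG) {T : Submodule R N} (hT : I • T = ⊥) :
    len R (I • ⊤ : Submodule R N) ≤ I.spanFinrank * len R (N ⧸ T) := by
  obtain ⟨s, hs, hspan⟩ := Submodule.FG.exists_span_finset_card_eq_spanFinrank hI
  have hle (x : s) : T ≤ LinearMap.ker (LinearMap.lsmul R N (x : R)) := fun t ht => by
    have hx : (x : R) ∈ I := hspan ▸ Submodule.subset_span x.2
    exact (Submodule.mem_bot R).1 (hT ▸ Submodule.smul_mem_smul hx ht)
  let φ : (s → N ⧸ T) →ₗ[R] N := ∑ x : s, T.liftQ _ (hle x) ∘ₗ LinearMap.proj x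
  have hφ : I • ⊤ ≤ LinearMap.range φ := Submodule.smul_le.2 fun r hr y _ => by
    rw [← hspan, ← Subtype.range_coe (s := (s : Set R))] at hr
    obtain ⟨c, rfl⟩ := Ideal.mem_span_range_iff_exists_fun.1 hr
    refine ⟨fun x => T.mkQ (c x • y), ?_⟩
    simp [φ, Finset.sum_smul, mul_smul, smul_comm (c _)]
  calc len R (I • ⊤ : Submodule R N) ≤ len R (LinearMap.range φ) := len_le_of_le hφ
    _ ≤ len R (s → N ⧸ T) := by rw [← len_ker_add_len_range φ]; exact Nat.le_add_left _ _
    _ = I.spanFinrank * len R (N ⧸ T) := by rw [len_fun, Fintype.card_coe, hs]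

variable [IsLocalRing R]

theorem socleRank_eq_len : socleRank R = len R (socle R) :=
  residueRank_eq_len _

theorem maximalIdeal_smul_socle : maximalIdeal R • socle R = ⊥ :=
  eq_bot_iff.2 <| Submodule.smul_le.2 fun r hr _ hs =>
    (Submodule.mem_torsionBySet_iff _ _).1 hs ⟨r, hr⟩

/-- The length of `𝔪 N`. -/
noncomputable def radLen (R : Type u) [CommRing R] [IsLocalRing R]
    (N : Type*) [AddCommGroup N] [Module R N] : ℕ :=
  len R (maximalIdeal R • ⊤ : Submodule R N)

section

variable {N : Type*} [AddCommGroup N] [Module R N]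

theorem radLen_residueField : radLen R (ResidueField R) = 0 := by
  have hbot : (maximalIdeal R • ⊤ : Submodule R (ResidueField R)) = ⊥ :=
    eq_bot_iff.2 fun _ hx => apply_eq_zero_of_mem_smul_top LinearMap.id hx
  rw [radLen, hbot, len_eq_zero_of_subsingleton]

theorem exists_apply_eq_one_of_notMem_smul_top {x : N}
    (hx : x ∉ maximalIdeal R • (⊤ : Submodule R N)) : ∃ g : N →ₗ[R] ResidueField R, g x = 1 := by
  have htorsion := Module.isTorsionBySet_quotient_ideal_smul N (maximalIdeal R)
  let : Module (ResidueField R) (N ⧸ maximalIdeal R • (⊤ : Submodule R N)) := htorsion.module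
  have : IsScalarTower R (ResidueField R) (N ⧸ maximalIdeal R • (⊤ : Submodule R N)) :=
    htorsion.isScalarTower
  obtain ⟨g, hg⟩ := Module.Projective.exists_dual_eq_one (ResidueField R)
    (mt (Submodule.Quotient.mk_eq_zero _).1 hx)
  exact ⟨g.restrictScalars R ∘ₗ Submodule.mkQ _, hg⟩

theorem hasResidueSummand_of_comp_eq_id {s : ResidueField R →ₗ[R] N}
    {g : N →ₗ[R] ResidueField R} (h : g ∘ₗ s = LinearMap.id) : HasResidueSummand R N := by
  have hg (x : ResidueField R) : g (s x) = x := LinearMap.congr_fun h x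
  refine ⟨LinearMap.range s, LinearMap.ker (s.rangeRestrict ∘ₗ g), LinearMap.isCompl_of_proj ?_,
    ⟨(LinearEquiv.ofInjective s (Function.LeftInverse.injective hg)).symm⟩⟩
  rintro ⟨_, y, rfl⟩
  exact Subtype.ext (congrArg s (hg y))

theorem hasResidueSummand_of_notMem_smul_top {x : N} (hx : ∀ r ∈ maximalIdeal R, r • x = 0)
    (hxm : x ∉ maximalIdeal R • (⊤ : Submodule R N)) : HasResidueSummand R N := by
  obtain ⟨g, hg⟩ := exists_apply_eq_one_of_notMem_smul_top hxm
  let s : R ⧸ maximalIdeal R →ₗ[R] N :=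
    (maximalIdeal R).liftQ (LinearMap.toSpanSingleton R N x) hx
  refine hasResidueSummand_of_comp_eq_id (s := s) (g := g) (Submodule.linearMap_qext _ ?_)
  ext
  change g (LinearMap.toSpanSingleton R N x 1) = 1
  rw [LinearMap.toSpanSingleton_apply_one, hg]

end

theorem embDim_pos [IsNoetherianRing R] (h : maximalIdeal R ≠ ⊥) : 0 < embDim R :=
  Nat.pos_of_ne_zero <| mt finrank_cotangentSpace_eq_zero_iff.1 (mt isField_iff_maximalIdeal_eq.1 h)

variable [IsArtinianRing R]

theorem len_maximalIdeal :
    len R (maximalIdeal R) = embDim R + len R (maximalIdeal R ^ 2 : Ideal R) := by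
  have hcot : len R (CotangentSpace R) = embDim R := by
    rw [len, Module.length_eq_of_surjective (R := ResidueField R) residue_surjective,
      Module.length_eq_rank]
    rfl
  rw [← len_add_len_quotient (maximalIdeal R • ⊤ : Submodule R (maximalIdeal R)),
    len_smul_top_submodule, smul_eq_mul, ← sq, add_comm, ← hcot]
  rfl

theorem len_self : len R R = 1 + len R (maximalIdeal R) := by
  rw [← len_add_len_quotient (maximalIdeal R), add_comm]
  exact congrArg (· + _) len_residueField

theorem radLen_le_embDim_mul {N : Type*} [AddCommGroup N] [Module R N] [Module.Finite R N]
    {T : Submodule R N} (hT : maximalIdeal R • T = ⊥) :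
    radLen R N ≤ embDim R * len R (N ⧸ T) := by
  rw [embDim, ← spanFinrank_maximalIdeal_eq_finrank_cotangentSpace]
  exact len_smul_top_le (maximalIdeal R).fg_of_isNoetherianRing hT

namespace IsMinimalCover

variable {N : Type*} [AddCommGroup N] [Module R N] {n : ℕ} {f : (Fin n → R) →ₗ[R] N}

theorem len_ker_add_radLen (hf : IsMinimalCover f) :
    len R (LinearMap.ker f) + radLen R N = n * len R (maximalIdeal R) := by
  rw [← len_smul_top_fun, ← len_ker_add_len_range (f.domRestrict (maximalIdeal R • ⊤)),
    LinearMap.range_domRestrict, Submodule.map_smul'', Submodule.map_top,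
    LinearMap.range_eq_top.2 hf.surjective, LinearMap.ker_domRestrict, radLen]
  exact congrArg (· + _) (len_congr (Submodule.comapSubtypeEquivOfLe hf.ker_le)).symm

theorem len_eq (hf : IsMinimalCover f) : len R N = n + radLen R N := by
  have hlen := len_ker_add_len_of_surjective hf.surjective
  have hker := hf.len_ker_add_radLen
  rw [len_fun, Fintype.card_fin, len_self, mul_add] at hlen
  lia

end IsMinimalCover

end Modules

section Resolution

variable {R : Type u} [CommRing R]

theorem smul_smul_top_eq_bot {N : Type*} [AddCommGroup N] [Module R N] {I J : Ideal R}
    (h : I * J = ⊥) : I • (J • ⊤ : Submodule R N) = ⊥ := by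
  rw [← Submodule.smul_assoc, smul_eq_mul, h, Submodule.bot_smul]

theorem smul_top_le_ker {N P : Type*} [AddCommGroup N] [Module R N] [AddCommGroup P] [Module R P]
    {f : N →ₗ[R] P} {I : Ideal R} (h : I • LinearMap.range f = ⊥) :
    I • ⊤ ≤ LinearMap.ker f := by
  rw [LinearMap.ker, ← Submodule.map_le_iff_le_comap, Submodule.map_smul'', Submodule.map_top, h]

theorem smul_top_eq_bot_of_injective {N P : Type*} [AddCommGroup N] [Module R N] [AddCommGroup P]
    [Module R P] {f : N →ₗ[R] P} (hf : Function.Injective f) {I : Ideal R}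
    (h : I • (⊤ : Submodule R P) = ⊥) : I • (⊤ : Submodule R N) = ⊥ := by
  refine eq_bot_iff.2 ((smul_top_le_ker ?_).trans (LinearMap.ker_eq_bot.2 hf).le)
  exact eq_bot_iff.2 (h ▸ Submodule.smul_mono le_rfl le_top)

theorem sq_mul_maximalIdeal [IsLocalRing R] (h3 : maximalIdeal R ^ 3 = ⊥) :
    maximalIdeal R ^ 2 * maximalIdeal R = ⊥ := by
  rw [← pow_succ, h3]

variable [IsLocalRing R]

theorem IsMinimalCover.radLen_le [IsArtinianRing R] {N : Type*} [AddCommGroup N] [Module R N]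
    {n : ℕ} {f : (Fin n → R) →ₗ[R] N} (hf : IsMinimalCover f)
    (hN : maximalIdeal R ^ 2 • (⊤ : Submodule R N) = ⊥) : radLen R N ≤ embDim R * n := by
  have : Module.Finite R N := Module.Finite.of_surjective f hf.surjective
  have hquot := len_add_len_quotient (maximalIdeal R • ⊤ : Submodule R N)
  rw [hf.len_eq, add_comm] at hquot
  have hT : maximalIdeal R • (maximalIdeal R • ⊤ : Submodule R N) = ⊥ := by
    rw [← Submodule.smul_assoc, smul_eq_mul, ← sq, hN]
  exact (radLen_le_embDim_mul hT).trans_eq (congrArg _ (Nat.add_right_cancel hquot))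

namespace MinimalFreeResolution

variable {M : Type u} [AddCommGroup M] [Module R M] (F : MinimalFreeResolution R M)

theorem isMinimalCover_aug : IsMinimalCover F.aug :=
  ⟨F.aug_surjective, F.exact_zero ▸ F.minimal 0⟩

theorem isMinimalCover_d (i : ℕ) : IsMinimalCover (F.d i).rangeRestrict where
  surjective := LinearMap.surjective_rangeRestrict _
  ker_le := by
    rw [LinearMap.ker_rangeRestrict, ← F.exact_succ]
    exact F.minimal (i + 1)

/-- The minimal free resolution of the first syzygy obtained by shifting. -/
def tail : MinimalFreeResolution R (LinearMap.range (F.d 0)) where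
  rank i := F.rank (i + 1)
  aug := (F.d 0).rangeRestrict
  d i := F.d (i + 1)
  aug_surjective := LinearMap.surjective_rangeRestrict _
  exact_zero := by rw [LinearMap.ker_rangeRestrict, F.exact_succ]
  exact_succ i := F.exact_succ (i + 1)
  minimal i := F.minimal (i + 1)

theorem residueSummand_tail (i : ℕ) :
    F.tail.ResidueSummandOfSyzygy i ↔ F.ResidueSummandOfSyzygy (i + 1) := by
  cases i <;> rfl

/-- The length of `𝔪 M_i`, where `M_i` is the `i`-th syzygy in the given resolution. -/
noncomputable def syzygyRadLen : ℕ → ℕ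
  | 0 => radLen R M
  | i + 1 => radLen R (LinearMap.range (F.d i))

theorem syzygyRadLen_tail (i : ℕ) : F.tail.syzygyRadLen i = F.syzygyRadLen (i + 1) := by
  cases i <;> rfl

theorem rank_eq_betti (i : ℕ) : F.rank i = betti R M i := by
  induction i generalizing M with
  | zero => exact F.isMinimalCover_aug.betti_zero.symm
  | succ i ih =>
    rw [F.isMinimalCover_aug.betti_succ, ← F.exact_zero, ← ih F.tail]
    rfl

theorem smul_range_d_eq_bot {I : Ideal R} (hI : I * maximalIdeal R = ⊥) (i : ℕ) :
    I • LinearMap.range (F.d i) = ⊥ :=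
  eq_bot_iff.2 <| (Submodule.smul_mono le_rfl (F.minimal i)).trans (smul_smul_top_eq_bot hI).le

theorem smul_top_range_d_eq_bot {I : Ideal R} (hI : I * maximalIdeal R = ⊥) (i : ℕ) :
    I • (⊤ : Submodule R (LinearMap.range (F.d i))) = ⊥ :=
  smul_top_eq_bot_of_le le_rfl (F.smul_range_d_eq_bot hI i)

theorem smul_top_le_range_d {I : Ideal R} (hI : I * maximalIdeal R = ⊥) (i : ℕ) :
    I • ⊤ ≤ LinearMap.range (F.d (i + 1)) :=
  F.exact_succ i ▸ smul_top_le_ker (F.smul_range_d_eq_bot hI i)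

theorem residueSummand_of_lt [IsArtinianRing R] (h3 : maximalIdeal R ^ 3 = ⊥) (i : ℕ)
    (hlt : F.syzygyRadLen (i + 2) < F.rank (i + 1) * len R (maximalIdeal R ^ 2 : Ideal R)) :
    F.ResidueSummandOfSyzygy (i + 2) := by
  rw [syzygyRadLen, radLen, len_smul_top_submodule, ← len_smul_top_fun] at hlt
  obtain ⟨x, hx, hxm⟩ := SetLike.not_le_iff_exists.1 fun hle => hlt.not_ge (len_le_of_le hle)
  have hsyz := F.smul_top_le_range_d (sq_mul_maximalIdeal h3) i hx
  refine hasResidueSummand_of_notMem_smul_top (x := ⟨x, hsyz⟩) (fun r hr => Subtype.ext ?_)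
    fun hmem => hxm ?_
  · have hrx := Submodule.smul_mem_smul hr hx
    rwa [smul_smul_top_eq_bot (by rw [← pow_succ', h3])] at hrx
  · have hmap := Submodule.mem_map_of_mem (f := Submodule.subtype _) hmem
    rwa [Submodule.map_smul'', Submodule.map_subtype_top] at hmap

variable [IsArtinianRing R]

theorem rank_add_syzygyRadLen (i : ℕ) :
    F.rank (i + 1) + F.syzygyRadLen (i + 1) + F.syzygyRadLen i =
      F.rank i * len R (maximalIdeal R) := by
  rw [syzygyRadLen, ← (F.isMinimalCover_d i).len_eq]
  cases i with
  | zero => rw [← F.isMinimalCover_aug.len_ker_add_radLen, ← F.exact_zero, syzygyRadLen]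
  | succ i =>
    rw [← (F.isMinimalCover_d i).len_ker_add_radLen, LinearMap.ker_rangeRestrict, ← F.exact_succ,
      syzygyRadLen]

theorem syzygyRadLen_succ_le_mul_len_sq (i : ℕ) :
    F.syzygyRadLen (i + 1) ≤ F.rank i * len R (maximalIdeal R ^ 2 : Ideal R) := by
  rw [syzygyRadLen, radLen, len_smul_top_submodule, ← len_smul_top_fun, sq, ← smul_eq_mul,
    Submodule.smul_assoc]
  exact len_le_of_le (Submodule.smul_mono le_rfl (F.minimal i))

theorem syzygyRadLen_le_embDim_mul (h3 : maximalIdeal R ^ 3 = ⊥) {n : ℕ}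
    (hn : 0 < n ∨ maximalIdeal R ^ 2 • (⊤ : Submodule R M) = ⊥) :
    F.syzygyRadLen n ≤ embDim R * F.rank n := by
  cases n with
  | zero => exact F.isMinimalCover_aug.radLen_le (hn.resolve_left (lt_irrefl 0))
  | succ n =>
    exact (F.isMinimalCover_d n).radLen_le (F.smul_top_range_d_eq_bot (sq_mul_maximalIdeal h3) n)

theorem syzygyRadLen_add_socle_le (i : ℕ) :
    F.syzygyRadLen (i + 2) + embDim R * (F.rank (i + 1) * len R (socle R)) ≤
      embDim R * (F.rank (i + 2) + F.syzygyRadLen (i + 2)) := by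
  let K := LinearMap.range (F.d (i + 1))
  let T : Submodule R (Fin (F.rank (i + 1)) → R) := socle R • ⊤
  have hTK : T ≤ K :=
    F.smul_top_le_range_d ((mul_comm _ _).trans maximalIdeal_smul_socle) i
  have hT : maximalIdeal R • T.comap K.subtype = ⊥ := by
    refine Submodule.map_injective_of_injective K.injective_subtype ?_
    rw [Submodule.map_smul'', Submodule.map_comap_subtype, inf_eq_right.2 hTK, Submodule.map_bot,
      smul_smul_top_eq_bot maximalIdeal_smul_socle]
  have hlenT : len R (T.comap K.subtype) = F.rank (i + 1) * len R (socle R) := by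
    rw [len_congr (Submodule.comapSubtypeEquivOfLe hTK), len_smul_top_fun]
  have hlenK : len R K = F.rank (i + 2) + F.syzygyRadLen (i + 2) :=
    (F.isMinimalCover_d (i + 1)).len_eq
  rw [← hlenK, ← len_add_len_quotient (T.comap K.subtype), hlenT, mul_add, add_comm]
  exact Nat.add_le_add_left (radLen_le_embDim_mul hT) _

theorem syzygyRadLen_eq_add_of_equiv_prod {P Q : Type u} [AddCommGroup P] [Module R P]
    [Module.Finite R P] [AddCommGroup Q] [Module R Q] [Module.Finite R Q] (e : M ≃ₗ[R] P × Q)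
    (G : MinimalFreeResolution R P) (H : MinimalFreeResolution R Q) (i : ℕ) :
    F.syzygyRadLen i = G.syzygyRadLen i + H.syzygyRadLen i := by
  have hrank (j : ℕ) : F.rank j = G.rank j + H.rank j := by
    simp only [rank_eq_betti, betti_eq_add_of_equiv_prod e j]
  induction i with
  | zero =>
    have hlen := (len_congr e).trans len_prod
    rw [F.isMinimalCover_aug.len_eq, G.isMinimalCover_aug.len_eq, H.isMinimalCover_aug.len_eq,
      hrank 0] at hlen
    simp only [syzygyRadLen]
    lia
  | succ i ih =>
    have hF := F.rank_add_syzygyRadLen i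
    rw [hrank i, hrank (i + 1), add_mul, ← G.rank_add_syzygyRadLen i,
      ← H.rank_add_syzygyRadLen i] at hF
    lia

theorem syzygyRadLen_lt_of_residueSummand {F : MinimalFreeResolution R M} {i n : ℕ}
    (hF : F.ResidueSummandOfSyzygy i) [Module.Finite R M] (h3 : maximalIdeal R ^ 3 = ⊥)
    (hin : 0 < i + n ∨ maximalIdeal R ^ 2 • (⊤ : Submodule R M) = ⊥)
    {G : MinimalFreeResolution R (ResidueField R)}
    (hG : G.syzygyRadLen n < embDim R * G.rank n) :
    F.syzygyRadLen (i + n) < embDim R * F.rank (i + n) := by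
  induction i generalizing M with
  | zero =>
    obtain ⟨P, Q, hPQ, ⟨e⟩⟩ := hF
    let split : M ≃ₗ[R] ResidueField R × Q :=
      (Submodule.prodEquivOfIsCompl P Q hPQ).symm.trans (e.prodCongr (LinearEquiv.refl R Q))
    obtain ⟨H⟩ := nonempty_minimalFreeResolution (R := R) Q
    rw [zero_add] at hin ⊢
    have hQ := H.syzygyRadLen_le_embDim_mul h3
      (hin.imp_right (smul_top_eq_bot_of_injective Q.injective_subtype))
    rw [F.syzygyRadLen_eq_add_of_equiv_prod split G H, F.rank_eq_betti,
      betti_eq_add_of_equiv_prod split, ← G.rank_eq_betti, ← H.rank_eq_betti, mul_add]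
    exact add_lt_add_of_lt_of_le hG hQ
  | succ i ih =>
    have htail := ih ((F.residueSummand_tail i).2 hF)
      (Or.inr (F.smul_top_range_d_eq_bot (sq_mul_maximalIdeal h3) 0))
    rw [syzygyRadLen_tail] at htail
    rw [Nat.add_right_comm i 1 n]
    exact htail

end MinimalFreeResolution

end Resolution

section Gorenstein

variable {R : Type u} [CommRing R]

theorem isFiniteLength_of_finite [IsArtinianRing R] (M : Type*) [AddCommGroup M] [Module R M]
    [Module.Finite R M] : IsFiniteLength R M :=
  Module.length_ne_top_iff.1 Module.length_ne_top

theorem length_hom_le_add {M : Type*} [AddCommGroup M] [Module R M] (N : Submodule R M)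
    (P : Type*) [AddCommGroup P] [Module R P] :
    Module.length R (M →ₗ[R] P) ≤
      Module.length R (LinearMap.range (LinearMap.lcomp R P N.subtype)) +
        Module.length R (M ⧸ N →ₗ[R] P) := by
  let res := (LinearMap.lcomp R P N.subtype).rangeRestrict
  have hexact : Function.Exact (LinearMap.lcomp R P N.mkQ) res := fun f => by
    rw [← LinearMap.exact_lcomp_of_exact_of_surjective P (LinearMap.exact_subtype_mkQ N)
      N.mkQ_surjective f]
    exact Subtype.ext_iff
  rw [Module.length_eq_add_of_exact _ res
    (LinearMap.lcomp_injective_of_surjective _ N.mkQ_surjective)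
    (LinearMap.surjective_rangeRestrict _) hexact, add_comm]

variable [IsLocalRing R]

theorem length_hom_residueField_le :
    Module.length R (R ⧸ maximalIdeal R →ₗ[R] R) ≤ Module.length R (socle R) := by
  let eval : (R ⧸ maximalIdeal R →ₗ[R] R) →ₗ[R] socle R :=
    (LinearMap.applyₗ 1).codRestrict (socle R) fun f =>
      (Submodule.mem_torsionBySet_iff _ _).2 fun r => by
        change (r : R) • f 1 = 0
        rw [← map_smul, Algebra.smul_def, mul_one, Ideal.Quotient.algebraMap_eq,
          Ideal.Quotient.eq_zero_iff_mem.2 r.2, map_zero]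
  refine Module.length_le_of_injective eval fun f g hfg => Submodule.linearMap_qext _ ?_
  ext
  exact congrArg Subtype.val hfg

theorem length_hom_self_le (hsocle : Module.length R (socle R) ≤ 1) {M : Type u} [AddCommGroup M]
    [Module R M] (hM : IsFiniteLength R M) :
    Module.length R (M →ₗ[R] R) ≤ Module.length R M := by
  induction hM with
  | of_subsingleton => rw [Module.length_eq_zero]; exact zero_le
  | @of_simple_quotient M _ _ N _ _ ih =>
    obtain ⟨I, hI, ⟨e⟩⟩ := isSimpleModule_iff_quot_maximal.1
      (inferInstance : IsSimpleModule R (M ⧸ N))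
    obtain rfl := eq_maximalIdeal hI
    have hsimple : Module.length R (M ⧸ N →ₗ[R] R) ≤ Module.length R (M ⧸ N) := by
      rw [Module.length_eq_one R (M ⧸ N), (e.congrLeft R R).length_eq]
      exact length_hom_residueField_le.trans hsocle
    calc Module.length R (M →ₗ[R] R) ≤ _ := length_hom_le_add N R
      _ ≤ Module.length R N + Module.length R (M ⧸ N) :=
        add_le_add ((Module.length_le_of_injective _ (Submodule.injective_subtype _)).trans ih)
          hsimple
      _ = Module.length R M := (Module.length_eq_add_of_exact N.subtype N.mkQ N.injective_subtype
          N.mkQ_surjective (LinearMap.exact_subtype_mkQ N)).symm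

-- The restriction `Hom(R, R) → Hom(I, R)` is onto because its image has length at least
-- `ℓ(R) - ℓ(Hom(R ⧸ I, R)) ≥ ℓ(R) - ℓ(R ⧸ I) = ℓ(I) ≥ ℓ(Hom(I, R))`.
theorem injective_self_of_length_socle_le_one [IsArtinianRing R]
    (hsocle : Module.length R (socle R) ≤ 1) : Module.Injective R R := by
  refine Module.Baer.injective (Module.Baer.iff_surjective.2 fun I => ?_)
  have hle (M : Type u) [AddCommGroup M] [Module R M] [Module.Finite R M] :=
    length_hom_self_le hsocle (isFiniteLength_of_finite (R := R) M)
  have hfin : IsFiniteLength R (I →ₗ[R] R) :=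
    Module.length_ne_top_iff.1 ((hle I).trans_lt Module.length_ne_top.lt_top).ne
  obtain ⟨_, _⟩ := isFiniteLength_iff_isNoetherian_isArtinian.1 hfin
  rw [← LinearMap.range_eq_top]
  by_contra hne
  have hlt := ENat.add_lt_add_of_lt_of_le Module.length_ne_top
    ((Submodule.length_lt hne).trans_le (hle I)) (hle (R ⧸ I))
  rw [← Module.length_eq_add_of_exact I.subtype I.mkQ I.injective_subtype I.mkQ_surjective
    (LinearMap.exact_subtype_mkQ I), ← (LinearMap.ringLmapEquivSelf R R R).length_eq] at hlt
  exact hlt.not_ge (length_hom_le_add I R)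

theorem isGorensteinLocal_of_len_socle_le_one [IsArtinianRing R] (hsocle : len R (socle R) ≤ 1) :
    IsGorensteinLocal R := by
  have hlength : Module.length R (socle R) ≤ 1 := by
    rw [← ENat.natCast_toNat (Module.length_ne_top (R := R) (M := socle R))]
    exact_mod_cast hsocle
  have := (Module.injective_iff_injective_object R R).1
    (injective_self_of_length_socle_le_one hlength)
  exact ⟨inferInstance, 0, inferInstance⟩

end Gorenstein

section MaximalIdealSyzygy

theorem three_mul_sum_range_mul_succ_add (n : ℕ) :
    3 * ∑ i ∈ Finset.range n, i * (i + 1) + n = n ^ 3 := by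
  induction n with
  | zero => rfl
  | succ n ih => rw [Finset.sum_range_succ]; linarith

-- The conditions `T(l, i, j) := ψ l (p i j) - ψ i (p l j) = 0` with `l < i` and `j ≤ i` imply all
-- others, since `T` is antisymmetric in `l, i` and `T(l, i, j) + T(i, j, l) + T(j, l, i) = 0`;
-- there are `n (n² - 1) / 3` of them.
theorem exists_symmetric_dual_family {K W : Type*} [Field K] [AddCommGroup W] [Module K W]
    [FiniteDimensional K W] {n : ℕ} (hn : 0 < n) (hdim : n ^ 2 ≤ 3 * Module.finrank K W)
    {p : Fin n → Fin n → W} (hp : ∀ i j, p i j = p j i) :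
    ∃ ψ : Fin n → Module.Dual K W, ψ ≠ 0 ∧ ∀ i j l, ψ l (p i j) = ψ i (p l j) := by
  let J := Σ i : Fin n, Finset.Iio i × Finset.Iic i
  let T : (Fin n → Module.Dual K W) →ₗ[K] (J → K) := LinearMap.pi fun t =>
    LinearMap.applyₗ (p t.1 t.2.2) ∘ₗ LinearMap.proj t.2.1.1 -
      LinearMap.applyₗ (p t.2.1 t.2.2) ∘ₗ LinearMap.proj t.1
  have hcard : Fintype.card J = ∑ i ∈ Finset.range n, i * (i + 1) := by
    simp only [J, Fintype.card_sigma, Fintype.card_prod, Fintype.card_coe, Fin.card_Iio,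
      Fin.card_Iic]
    exact Fin.sum_univ_eq_sum_range (fun i => i * (i + 1)) n
  have hlt : Module.finrank K (J → K) < Module.finrank K (Fin n → Module.Dual K W) := by
    rw [Module.finrank_pi, Module.finrank_pi_fintype, hcard]
    simp only [Subspace.dual_finrank_eq, Finset.sum_const, Finset.card_univ, Fintype.card_fin,
      smul_eq_mul]
    nlinarith [three_mul_sum_range_mul_succ_add n, Nat.mul_le_mul_left n hdim]
  obtain ⟨ψ, hψ, hne⟩ :=
    Submodule.exists_mem_ne_zero_of_ne_bot (LinearMap.ker_ne_bot_of_finrank_lt (f := T) hlt)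
  have hT {l i j : Fin n} (hl : l < i) (hj : j ≤ i) : ψ l (p i j) = ψ i (p l j) :=
    sub_eq_zero.1 <| congrFun (LinearMap.mem_ker.1 hψ)
      ⟨i, ⟨l, Finset.mem_Iio.2 hl⟩, ⟨j, Finset.mem_Iic.2 hj⟩⟩
  have hlt {l i : Fin n} (hl : l < i) (j : Fin n) : ψ l (p i j) = ψ i (p l j) := by
    rcases le_or_gt j i with hj | hj
    · exact hT hl hj
    · rw [hp i j, hT (hl.trans hj) hj.le, hp l i, ← hT hj (hl.trans hj).le, hp j l]
  refine ⟨ψ, hne, fun i j l => ?_⟩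
  rcases lt_trichotomy l i with hl | rfl | hl
  · exact hlt hl j
  · rfl
  · exact (hlt hl j).symm

theorem sum_apply_mul_eq_zero {R A W B ι : Type*} [CommRing R] [AddCommGroup A] [Module R A]
    [AddCommGroup W] [Module R W] [AddCommGroup B] [Module R B] [Fintype ι]
    {μ : A →ₗ[R] A →ₗ[R] W} {x : ι → A} (hx : Submodule.span R (Set.range x) = ⊤)
    {ψ : ι → W →ₗ[R] B} (hψ : ∀ i j l, ψ l (μ (x i) (x j)) = ψ i (μ (x l) (x j)))
    {c : ι → A} (hc : ∑ l, μ (x l) (c l) = 0) (y : A) : ∑ l, ψ l (μ y (c l)) = 0 := by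
  have hswap (i l : ι) : ψ l ∘ₗ μ (x i) = ψ i ∘ₗ μ (x l) :=
    LinearMap.ext_on_range hx fun j => hψ i j l
  have hzero : ∑ l, ψ l ∘ₗ μ.flip (c l) = 0 := LinearMap.ext_on_range hx fun i => by
    calc (∑ l, ψ l ∘ₗ μ.flip (c l)) (x i) = ∑ l, ψ i (μ (x l) (c l)) := by
          rw [LinearMap.sum_apply]
          exact Finset.sum_congr rfl fun l _ => LinearMap.congr_fun (hswap i l) (c l)
      _ = 0 := by rw [← map_sum, hc, map_zero]
  rw [← LinearMap.zero_apply (σ₁₂ := RingHom.id R) y, ← hzero, LinearMap.sum_apply]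
  rfl

variable {R : Type u} [CommRing R]

/-- The multiplication `I × I → I²` of an ideal as a bilinear map. -/
def idealMul (I : Ideal R) : I →ₗ[R] I →ₗ[R] (I ^ 2 : Ideal R) :=
  LinearMap.mk₂ R (fun y z => ⟨y * z, sq I ▸ Ideal.mul_mem_mul y.2 z.2⟩)
    (fun _ _ _ => Subtype.ext (add_mul _ _ _)) (fun _ _ _ => Subtype.ext (mul_assoc _ _ _))
    (fun _ _ _ => Subtype.ext (mul_add _ _ _)) (fun _ _ _ => Subtype.ext (mul_left_comm _ _ _))

theorem idealMul_comm {I : Ideal R} (y z : I) : idealMul I y z = idealMul I z y :=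
  Subtype.ext (mul_comm _ _)

theorem span_range_apply_single_eq_top {N ι : Type*} [AddCommGroup N] [Module R N] [Finite ι]
    [DecidableEq ι] {f : (ι → R) →ₗ[R] N} (hf : Function.Surjective f) :
    Submodule.span R (Set.range fun i => f (Pi.single i 1)) = ⊤ := by
  have := Fintype.ofFinite ι
  have hspan := congrArg (Submodule.map f) (Pi.basisFun R ι).span_eq
  rw [Submodule.map_span, ← Set.range_comp, Submodule.map_top, LinearMap.range_eq_top.2 hf] at hspan
  simpa only [Function.comp_def, Pi.basisFun_apply] using hspan

variable [IsLocalRing R]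

theorem exists_symmetric_family_of_isTorsionBySet {V : Type*} [AddCommGroup V] [Module R V]
    [Module.Finite R V] (hV : Module.IsTorsionBySet R V (maximalIdeal R)) {n : ℕ} (hn : 0 < n)
    (hlen : n ^ 2 ≤ 3 * len R V) {p : Fin n → Fin n → V} (hp : ∀ i j, p i j = p j i) :
    ∃ ψ : Fin n → V →ₗ[R] ResidueField R, ψ ≠ 0 ∧ ∀ i j l, ψ l (p i j) = ψ i (p l j) := by
  let : Module (ResidueField R) V := hV.module
  have : IsScalarTower R (ResidueField R) V := hV.isScalarTower
  have : Module.Finite (ResidueField R) V := Module.Finite.of_restrictScalars_finite R _ _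
  obtain ⟨ψ, hne, hψ⟩ := exists_symmetric_dual_family (K := ResidueField R) hn
    (hlen.trans_eq (congrArg _ (residueRank_eq_len hV).symm)) hp
  have : LinearMap.CompatibleSMul V (ResidueField R) R (ResidueField R) :=
    LinearMap.IsScalarTower.compatibleSMul
  refine ⟨fun l => (ψ l).restrictScalars R, fun h => hne (funext fun l => ?_), hψ⟩
  exact LinearMap.restrictScalars_injective R (congrFun h l)

theorem IsMinimalCover.radLen_ker_lt [IsArtinianRing R] (h3 : maximalIdeal R ^ 3 = ⊥) {n : ℕ}
    (hn : 0 < n) (hlen : n ^ 2 ≤ 3 * len R (maximalIdeal R ^ 2 : Ideal R))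
    {f : (Fin n → R) →ₗ[R] maximalIdeal R} (hf : IsMinimalCover f) :
    radLen R (LinearMap.ker f) < n * len R (maximalIdeal R ^ 2 : Ideal R) := by
  let x (i : Fin n) : maximalIdeal R := f (Pi.single i 1)
  have hfx (c : Fin n → R) : f c = ∑ l, c l • x l := by
    conv_lhs => rw [pi_eq_sum_univ' c]
    simp only [map_sum, map_smul, x]
  have hx : Submodule.span R (Set.range x) = ⊤ := span_range_apply_single_eq_top hf.surjective
  obtain ⟨ψ, hne, hψ⟩ := exists_symmetric_family_of_isTorsionBySet (isTorsionBySet_sq h3) hn hlen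
    fun i j => idealMul_comm (x i) (x j)
  let Φ := LinearMap.lsum R (fun _ => (maximalIdeal R ^ 2 : Ideal R)) R ψ
  let incl := (maximalIdeal R ^ 2).subtype.compLeft (Fin n)
  have hincl : Function.Injective incl := (Submodule.injective_subtype _).comp_left
  have hker : maximalIdeal R • LinearMap.ker f ≤ (LinearMap.ker Φ).map incl := by
    refine Submodule.smul_le.2 fun y hy c hc => ?_
    let c' (l : Fin n) : maximalIdeal R := ⟨c l, (mem_smul_top_fun _).1 (hf.ker_le hc) l⟩
    have hsum : ∑ l, idealMul _ (x l) (c' l) = 0 := Subtype.ext <| by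
      have hval := congrArg Subtype.val ((hfx c).symm.trans hc)
      rw [AddSubmonoidClass.coe_finsetSum] at hval ⊢
      exact (Finset.sum_congr rfl fun l _ => mul_comm _ _).trans hval
    refine ⟨fun l => idealMul _ ⟨y, hy⟩ (c' l), LinearMap.mem_ker.2 ?_, rfl⟩
    exact (LinearMap.sum_apply _ _ _).trans (sum_apply_mul_eq_zero hx hψ hsum ⟨y, hy⟩)
  have hΦ : Φ ≠ 0 := (LinearEquiv.map_ne_zero_iff _).2 hne
  calc radLen R (LinearMap.ker f)
      ≤ len R ((LinearMap.ker Φ).map incl) := by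
        rw [radLen, len_smul_top_submodule]
        exact len_le_of_le hker
    _ = len R (LinearMap.ker Φ) := (len_congr (Submodule.equivMapOfInjective _ hincl _)).symm
    _ < len R (Fin n → (maximalIdeal R ^ 2 : Ideal R)) := len_ker_lt hΦ
    _ = n * len R (maximalIdeal R ^ 2 : Ideal R) := by rw [len_fun, Fintype.card_fin]

theorem IsMinimalCover.eq_embDim [IsArtinianRing R] {n : ℕ}
    {f : (Fin n → R) →ₗ[R] maximalIdeal R} (hf : IsMinimalCover f) : n = embDim R := by
  have hlen := hf.len_eq
  rw [radLen, len_smul_top_submodule, smul_eq_mul, ← sq, len_maximalIdeal] at hlen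
  exact (Nat.add_right_cancel hlen).symm

namespace MinimalFreeResolution

variable (G : MinimalFreeResolution R (ResidueField R))

theorem syzygyRadLen_zero_residueField : G.syzygyRadLen 0 = 0 :=
  radLen_residueField

theorem range_d_zero_residueField : LinearMap.range (G.d 0) = maximalIdeal R • ⊤ := by
  refine le_antisymm (G.minimal 0) (G.exact_zero ▸ smul_top_le_ker ?_)
  exact eq_bot_iff.2 fun x hx => apply_eq_zero_of_mem_smul_top LinearMap.id
    (Submodule.smul_mono le_rfl le_top hx)

variable [IsArtinianRing R]

theorem rank_zero_residueField : G.rank 0 = 1 := by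
  have hlen := G.isMinimalCover_aug.len_eq
  rwa [len_residueField, radLen_residueField, eq_comm] at hlen

theorem exists_isMinimalCover_maximalIdeal :
    ∃ f : (Fin (G.rank 1) → R) →ₗ[R] maximalIdeal R,
      IsMinimalCover f ∧ LinearMap.ker f = LinearMap.range (G.d 1) := by
  have : Unique (Fin (G.rank 0)) := G.rank_zero_residueField ▸ inferInstance
  let eval : (Fin (G.rank 0) → R) ≃ₗ[R] R := LinearEquiv.funUnique _ R R
  have hmap : (LinearMap.range (G.d 0)).map (eval : (Fin (G.rank 0) → R) →ₗ[R] R) =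
      maximalIdeal R := by
    rw [G.range_d_zero_residueField, Submodule.map_smul'', Submodule.map_top, LinearEquiv.range,
      smul_eq_mul, Ideal.mul_top]
  let e : LinearMap.range (G.d 0) ≃ₗ[R] maximalIdeal R :=
    (eval.submoduleMap _).trans (LinearEquiv.ofEq _ _ hmap)
  have hker : LinearMap.ker (e.toLinearMap ∘ₗ (G.d 0).rangeRestrict) = LinearMap.range (G.d 1) := by
    rw [LinearEquiv.ker_comp, LinearMap.ker_rangeRestrict, G.exact_succ]
  exact ⟨_, ⟨e.surjective.comp (G.isMinimalCover_d 0).surjective, hker ▸ G.minimal 1⟩, hker⟩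

theorem rank_one_residueField : G.rank 1 = embDim R :=
  G.exists_isMinimalCover_maximalIdeal.choose_spec.1.eq_embDim

theorem syzygyRadLen_two_residueField_lt (h3 : maximalIdeal R ^ 3 = ⊥) (he : 0 < embDim R)
    (ha : embDim R ^ 2 ≤ 3 * len R (maximalIdeal R ^ 2 : Ideal R)) :
    G.syzygyRadLen 2 < G.rank 1 * len R (maximalIdeal R ^ 2 : Ideal R) := by
  obtain ⟨f, hf, hker⟩ := G.exists_isMinimalCover_maximalIdeal
  rw [syzygyRadLen, ← hker]
  rw [← G.rank_one_residueField] at he ha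
  exact hf.radLen_ker_lt h3 he ha

end MinimalFreeResolution

end MaximalIdealSyzygy

section Growth

theorem strictMono_and_growth_of_mul_le_mul {b : ℕ → ℕ} {p q : ℕ} (hq : 0 < q) (hqp : q < p)
    (hb : b 0 < b 1) (h : ∀ i, p * b (i + 1) ≤ q * b (i + 2)) :
    StrictMono b ∧ TermwiseExponentialGrowth b := by
  have hlt (i : ℕ) : b i < b (i + 1) := by
    induction i with
    | zero => exact hb
    | succ i ih =>
      exact lt_of_mul_lt_mul_left'
        ((Nat.mul_lt_mul_of_pos_right hqp (Nat.zero_lt_of_lt ih)).trans_le (h i))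
  refine ⟨strictMono_nat_of_lt_succ hlt, p / q, ?_, ?_⟩
  · rw [one_lt_div (Nat.cast_pos.2 hq)]
    exact_mod_cast hqp
  · filter_upwards [eventually_ge_atTop 1] with i hi
    obtain ⟨i, rfl⟩ := Nat.exists_eq_add_of_le' hi
    rw [div_mul_eq_mul_div, div_le_iff₀ (Nat.cast_pos.2 hq), mul_comm (b (i + 1 + 1) : ℝ)]
    exact_mod_cast h i

-- The increments at least double, so `b (i + 1) - b i ≥ b i / (b 0 + 1)` propagates.
theorem strictMono_and_growth_of_three_mul_le {b : ℕ → ℕ} (hb : b 0 < b 1)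
    (h : ∀ i, b i ≤ b (i + 1) → 3 * b (i + 1) ≤ b (i + 2) + 2 * b i) :
    StrictMono b ∧ TermwiseExponentialGrowth b := by
  have hgrowth (i : ℕ) : (b 0 + 2) * b i ≤ (b 0 + 1) * b (i + 1) := by
    induction i with
    | zero => nlinarith
    | succ i ih =>
      have hle : b i ≤ b (i + 1) := by nlinarith
      nlinarith [h i hle]
  exact strictMono_and_growth_of_mul_le_mul (Nat.succ_pos _) (Nat.lt_succ_self _) hb
    fun i => hgrowth (i + 1)

/-- The relations between the Betti numbers `b i` of a module and the lengths `s i` of `𝔪 M_i`,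
where `a`, `e`, `r` are the ranks of `𝔪²`, `𝔪/𝔪²` and the socle: the growth of the Betti numbers
depends only on these relations. -/
structure SyzygyRelations (a e r : ℕ) (b s : ℕ → ℕ) : Prop where
  sum_eq : ∀ i, b (i + 1) + s (i + 1) + s i = b i * (e + a)
  le_mul : ∀ i, s (i + 1) ≤ b i * a
  socle : ∀ i, s (i + 2) + e * (b (i + 1) * r) ≤ e * (b (i + 2) + s (i + 2))

namespace SyzygyRelations

section

variable {a e r : ℕ} {b s : ℕ → ℕ} (h : SyzygyRelations a e r b s)

include h

theorem linear_bound (i : ℕ) : e * b (i + 1) ≤ b (i + 2) + a * b i := by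
  linarith [h.sum_eq (i + 1), h.le_mul i, h.le_mul (i + 1)]

theorem ratio_bound (he : 0 < e) (i : ℕ) :
    (e * r + a) * b (i + 1) ≤ e * b (i + 2) + e * a * b (i + 1) := by
  obtain ⟨c, rfl⟩ := Nat.exists_eq_add_of_le' he
  linarith [h.socle i, Nat.mul_le_mul_left c (h.le_mul (i + 1))]

theorem strictMono_and_growth (he : 0 < e) (ha : 0 < a) (har : a ≤ r) (hr : 2 ≤ r)
    (hb : b 0 < b 1) (hne : a ≠ e ∨ a ≠ r) : StrictMono b ∧ TermwiseExponentialGrowth b := by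
  obtain ⟨d, rfl⟩ := Nat.exists_eq_add_of_le har
  rcases Nat.lt_or_ge e (e * d + a) with hlt | hge
  · refine strictMono_and_growth_of_mul_le_mul he hlt hb fun i => ?_
    linarith [h.ratio_bound he i]
  · obtain rfl : d = 0 := by
      by_contra hd
      linarith [Nat.le_mul_of_pos_right e (Nat.pos_of_ne_zero hd)]
    have hae : a + 1 ≤ e := by lia
    refine strictMono_and_growth_of_three_mul_le hb fun i hi => ?_
    obtain ⟨δ, hδ⟩ := Nat.exists_eq_add_of_le hi
    have hlin := h.linear_bound i
    have hmul := Nat.mul_le_mul_right (b (i + 1)) hae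
    have hinc := Nat.mul_le_mul_right δ hr
    rw [hδ] at *
    linarith

theorem mul_le_two_mul_succ (ha : 4 * a ≤ e ^ 2) (hb : e * b 0 ≤ 2 * b 1) (n : ℕ) :
    e * b n ≤ 2 * b (n + 1) := by
  induction n with
  | zero => exact hb
  | succ n ih =>
    linarith [h.linear_bound n, Nat.mul_le_mul_right (b n) ha, Nat.mul_le_mul_left e ih]

end

variable {e : ℕ} {b s : ℕ → ℕ} (h : SyzygyRelations e e e b s)

include h

theorem le_succ (he : 0 < e) (i : ℕ) : b (i + 1) ≤ b (i + 2) :=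
  Nat.le_of_mul_le_mul_left (by linarith [h.ratio_bound he i]) he

theorem monotone (he : 0 < e) (hb : b 0 < b 1) : Monotone b :=
  monotone_nat_of_le_succ fun i => by
    cases i with
    | zero => exact hb.le
    | succ i => exact h.le_succ he i

theorem mul_le_of_le (he : 2 ≤ e) {i : ℕ} (hi : b (i + 2) ≤ b (i + 1)) :
    e * b (i + 2) ≤ s (i + 2) := by
  obtain ⟨c, rfl⟩ := Nat.exists_eq_add_of_le' (Nat.le_of_succ_le he)
  refine Nat.le_of_mul_le_mul_left ?_ (Nat.lt_of_succ_lt_succ he : 0 < c)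
  linarith [h.socle i, Nat.mul_le_mul_left ((c + 1) ^ 2) hi]

theorem lt_mul_of_le (he : 2 ≤ e) (hb : b 0 < b 1) {i : ℕ} (hi : b (i + 2) ≤ b (i + 1)) :
    s (i + 3) < b (i + 2) * e := by
  have hpos : 0 < b (i + 3) :=
    (Nat.zero_lt_of_lt hb).trans_le (h.monotone (Nat.zero_lt_of_lt he) hb (by lia))
  linarith [h.sum_eq (i + 2), h.mul_le_of_le he hi]

end SyzygyRelations

end Growth

section Repetition

variable {R : Type u} [CommRing R] [IsLocalRing R]

theorem isArtinianRing_of_maximalIdeal_pow_eq_bot [IsNoetherianRing R] {n : ℕ}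
    (h : maximalIdeal R ^ n = ⊥) : IsArtinianRing R :=
  isArtinianRing_iff_isNilpotent_maximalIdeal R |>.2 ⟨n, h⟩

theorem sq_le_socle (h3 : maximalIdeal R ^ 3 = ⊥) : maximalIdeal R ^ 2 ≤ socle R := fun x hx =>
  (Submodule.mem_torsionBySet_iff _ _).2 fun y =>
    congrArg Subtype.val (isTorsionBySet_sq h3 (x := ⟨x, hx⟩) (a := y))

variable [IsArtinianRing R]

namespace MinimalFreeResolution

theorem syzygyRelations {M : Type u} [AddCommGroup M] [Module R M]
    (F : MinimalFreeResolution R M) :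
    SyzygyRelations (len R (maximalIdeal R ^ 2 : Ideal R)) (embDim R) (len R (socle R))
      F.rank F.syzygyRadLen where
  sum_eq i := by rw [F.rank_add_syzygyRadLen, len_maximalIdeal]
  le_mul := F.syzygyRadLen_succ_le_mul_len_sq
  socle := F.syzygyRadLen_add_socle_le

section ResidueField

variable (G : MinimalFreeResolution R (ResidueField R))

theorem syzygyRadLen_residueField_lt_of_four_mul_le (he : 0 < embDim R)
    (ha : 4 * len R (maximalIdeal R ^ 2 : Ideal R) ≤ embDim R ^ 2) (n : ℕ) :
    G.syzygyRadLen n < embDim R * G.rank n := by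
  have hratio : ∀ n, embDim R * G.rank n ≤ 2 * G.rank (n + 1) :=
    G.syzygyRelations.mul_le_two_mul_succ ha (by
      rw [G.rank_zero_residueField, G.rank_one_residueField]
      lia)
  have hpos (n : ℕ) : 0 < embDim R * G.rank n := by
    induction n with
    | zero => rwa [G.rank_zero_residueField, mul_one]
    | succ n ih => exact Nat.mul_pos he (by linarith [hratio n])
  cases n with
  | zero => exact G.syzygyRadLen_zero_residueField.trans_lt (hpos 0)
  | succ n =>
    linarith [G.syzygyRadLen_succ_le_mul_len_sq n, Nat.mul_le_mul_left (G.rank n) ha,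
      Nat.mul_le_mul_left (embDim R) (hratio n), hpos (n + 1)]

theorem syzygyRadLen_residueField_lt_of_sq_le_three_mul (h3 : maximalIdeal R ^ 3 = ⊥)
    (hae : len R (maximalIdeal R ^ 2 : Ideal R) < embDim R ^ 2)
    (ha : embDim R ^ 2 ≤ 3 * len R (maximalIdeal R ^ 2 : Ideal R)) (n : ℕ) :
    G.syzygyRadLen n < embDim R * G.rank n := by
  have he : 0 < embDim R := Nat.pos_of_ne_zero fun h0 => by simp [h0] at hae
  have hk : G.ResidueSummandOfSyzygy 2 :=
    G.residueSummand_of_lt h3 0 (G.syzygyRadLen_two_residueField_lt h3 he ha)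
  induction n using Nat.twoStepInduction with
  | zero => rwa [G.syzygyRadLen_zero_residueField, G.rank_zero_residueField, mul_one]
  | one =>
    have hone := G.syzygyRadLen_succ_le_mul_len_sq 0
    rw [G.rank_zero_residueField, one_mul] at hone
    rw [G.rank_one_residueField, ← sq]
    exact hone.trans_lt hae
  | more n ih _ =>
    rw [add_comm n 2]
    exact syzygyRadLen_lt_of_residueSummand hk h3 (Or.inl (by lia)) ih

theorem syzygyRadLen_residueField_lt (h3 : maximalIdeal R ^ 3 = ⊥) (he : 2 ≤ embDim R)
    (ha : len R (maximalIdeal R ^ 2 : Ideal R) = embDim R) (n : ℕ) :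
    G.syzygyRadLen n < embDim R * G.rank n := by
  rcases le_or_gt 4 (embDim R) with h4 | h4
  · exact G.syzygyRadLen_residueField_lt_of_four_mul_le (by lia) (by nlinarith) n
  · exact G.syzygyRadLen_residueField_lt_of_sq_le_three_mul h3 (by nlinarith) (by nlinarith) n

end ResidueField

variable {M : Type u} [AddCommGroup M] [Module R M] [Module.Finite R M]

theorem residueSummand_of_not_rank_lt (F : MinimalFreeResolution R M)
    (h3 : maximalIdeal R ^ 3 = ⊥) (he : 2 ≤ embDim R)
    (ha : len R (maximalIdeal R ^ 2 : Ideal R) = embDim R) (hr : len R (socle R) = embDim R)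
    (hF : F.rank 0 < F.rank 1) {j : ℕ} (hj : 1 ≤ j) (hnot : ¬ F.rank (j - 1) < F.rank j) :
    2 ≤ j ∧ F.ResidueSummandOfSyzygy (j + 1) ∧ ∀ i ≤ j, ¬ F.ResidueSummandOfSyzygy i := by
  have hrel := F.syzygyRelations
  rw [ha, hr] at hrel
  obtain ⟨j, rfl⟩ : ∃ i, j = i + 2 := by
    refine Nat.exists_eq_add_of_le' (hj.lt_of_ne' ?_)
    rintro rfl
    exact hnot hF
  have hle : F.rank (j + 2) ≤ F.rank (j + 1) := not_lt.1 hnot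
  refine ⟨by lia, F.residueSummand_of_lt h3 (j + 1) (ha.symm ▸ hrel.lt_mul_of_le he hF hle),
    fun i hi hk => (hrel.mul_le_of_le he hle).not_gt ?_⟩
  obtain ⟨G⟩ := nonempty_minimalFreeResolution (R := R) (ResidueField R)
  obtain ⟨n, hn⟩ := Nat.exists_eq_add_of_le hi
  rw [hn]
  exact syzygyRadLen_lt_of_residueSummand hk h3 (Or.inl (by lia))
    (G.syzygyRadLen_residueField_lt h3 he ha n)

end MinimalFreeResolution

end Repetition

end LocalRingBetti

theorem mainTheorem5 (R : Type u) [CommRing R] [IsLocalRing R] [IsNoetherianRing R]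
    (h3 : IsLocalRing.maximalIdeal R ^ 3 = ⊥) (h2 : IsLocalRing.maximalIdeal R ^ 2 ≠ ⊥)
    (hG : ¬ LocalRingBetti.IsGorensteinLocal R)
    (M : Type u) [AddCommGroup M] [Module R M] [Module.Finite R M]
    (hM : LocalRingBetti.betti R M 0 < LocalRingBetti.betti R M 1)
    (a e r : ℕ)
    (ha : a = LocalRingBetti.residueRank (LocalRingBetti.isTorsionBySet_sq h3))
    (he : e = LocalRingBetti.embDim R)
    (hr : r = LocalRingBetti.socleRank R) :
    ((a ≠ e ∨ a ≠ r) →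
      StrictMono (LocalRingBetti.betti R M) ∧
        LocalRingBetti.TermwiseExponentialGrowth (LocalRingBetti.betti R M)) ∧
    ((a = e ∧ e = r) →
      Monotone (LocalRingBetti.betti R M) ∧
      {i : ℕ | 1 ≤ i ∧ ¬ LocalRingBetti.betti R M (i - 1) <
        LocalRingBetti.betti R M i}.Subsingleton ∧
      ∀ j : ℕ, 1 ≤ j → LocalRingBetti.betti R M j = LocalRingBetti.betti R M (j - 1) →
        2 ≤ j ∧
        ∀ F : LocalRingBetti.MinimalFreeResolution R M,
          F.ResidueSummandOfSyzygy (j + 1) ∧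
          ∀ i : ℕ, i ≤ j → ¬ F.ResidueSummandOfSyzygy i) := by
  open LocalRingBetti in
  have : IsArtinianRing R := isArtinianRing_of_maximalIdeal_pow_eq_bot h3
  have : Nontrivial (maximalIdeal R ^ 2 : Ideal R) := Submodule.nontrivial_iff_ne_bot.2 h2
  rw [residueRank_eq_len] at ha
  rw [socleRank_eq_len] at hr
  have hrank (F : MinimalFreeResolution R M) : F.rank = betti R M := funext F.rank_eq_betti
  obtain ⟨F₀⟩ := nonempty_minimalFreeResolution (R := R) M
  have hrel := hrank F₀ ▸ F₀.syzygyRelations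
  have hr2 : 2 ≤ r := hr ▸ lt_of_not_ge fun h => hG (isGorensteinLocal_of_len_socle_le_one h)
  have har : a ≤ r := ha ▸ hr ▸ len_le_of_le (sq_le_socle h3)
  have he0 : 0 < e := he ▸ embDim_pos (ne_bot_of_le_ne_bot h2 (Ideal.pow_le_self two_ne_zero))
  rw [← ha, ← he, ← hr] at hrel
  refine ⟨hrel.strictMono_and_growth he0 (ha ▸ len_pos) har hr2 hM, ?_⟩
  rintro ⟨rfl, rfl⟩
  have hrep (F : MinimalFreeResolution R M) {j : ℕ} (hj : 1 ≤ j)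
      (hnot : ¬ betti R M (j - 1) < betti R M j) :=
    F.residueSummand_of_not_rank_lt h3 (he ▸ hr2) (ha ▸ he) (hr ▸ he) (hrank F ▸ hM) hj
      (hrank F ▸ hnot)
  have hle {i j : ℕ} (hi : 1 ≤ i) (hi' : ¬ betti R M (i - 1) < betti R M i) (hj : 1 ≤ j)
      (hj' : ¬ betti R M (j - 1) < betti R M j) : i ≤ j :=
    not_lt.1 fun hji => (hrep F₀ hi hi').2.2 (j + 1) hji (hrep F₀ hj hj').2.1
  exact ⟨hrel.monotone he0 hM,
    fun i hi j hj => le_antisymm (hle hi.1 hi.2 hj.1 hj.2) (hle hj.1 hj.2 hi.1 hi.2),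
    fun j hj heq => ⟨(hrep F₀ hj heq.not_gt).1, fun F => (hrep F hj heq.not_gt).2⟩⟩
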